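/- A (Clifford) ZX diagram is a finite open graph whose internal vertices are Z spiders, X spiders (with phases in $\{0,\frac{\pi}{2},\pi,\frac{3\pi}{2}\}$) and two-legged Hadamard boxes, and whose boundary vertices have degree one; its interpretation $[\![D]\!]$ is the linear map obtained by contracting the tensors $|0\cdots0\rangle+e^{i\alpha}|1\cdots1\rangle$, $|{+}\cdots{+}\rangle+e^{i\alpha}|{-}\cdots{-}\rangle$ and $|0\rangle\langle+|+|1\rangle\langle-|$ of its vertices. Interpretations are compared up to a nonzero scalar. An error $\mathcal E$ in $D$ is a set of pairs $(e,t)$ with $e$ an edge and $t\in\{X,Z\}$; $D+\mathcal E$ is $D$ with the corresponding Pauli operators inserted on its edges, and the weight of $\mathcal E$ is the number of distinct edges occurring in it. The ZX distance of $D$ is the minimal weight of an error $\mathcal E$ with $[\![D+\mathcal E]\!]\neq[\![D]\!]$ and $[\![D+\mathcal E]\!]\neq0$ (it is $\infty$ if there is none). A rewrite $D_1\to D_2$ between diagrams with the same boundary and with $[\![D_1]\!]=[\![D_2]\!]$ is distance-preserving if, for every diagram $D$ in which $D_1$ occurs, the diagram obtained from $D$ by replacing $D_1$ by $D_2$ has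 ZX distance at least that of $D$, and the same holds for the inverse rewrite $D_2\to D_1$. Theorem. Let $n$ be an even natural number. Let $D_1$ be the phase-free Z spider with $n+1$ legs. Let $D_2$ be the diagram with the same $n+1$ boundary vertices that consists of the following phase-free Z spiders: $\frac n2$ four-legged spiders $s_1,\dots,s_{n/2}$, a spider $a$ with $\frac n2$ legs, and a spider $b$ with $\frac n2+1$ legs. Each $s_i$ is connected by one edge to $a$, by one edge to $b$, and to the boundary vertices $2i-1$ and $2i$; the remaining leg of $b$ is connected to the boundary vertex $n+1$. Then $[\![D_1]\!]=[\![D_2]\!]$ (up to a nonzero scalar) and the rewrite $D_1\to D_2$ is distance-preserving. -/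

import Mathlib

/-! Clifford ZX diagrams as open graphs, their interpretation, errors made of edge flips, the ZX
distance, and distance-preserving rewrites. -/

/-- The types of the non-boundary nodes of a ZX diagram: Z spiders, X spiders, Hadamard boxes. -/
inductive NodeKind
  | Z
  | X
  | H

/-- The two types of edge flips. -/
inductive FlipKind
  | X
  | Z

/-- A Clifford ZX diagram whose boundary nodes are labelled by `ι`. It is a finite open graph
(parallel edges and self-loops are allowed) with vertex set `Node ⊕ ι`. An edge `e` has the two
half-edges `(e, false)` and `(e, true)`, and `attach` sends a half-edge to its vertex. The phase of
a spider `v` is `phase v * π / 2`; the phase of a Hadamard box plays no role. Hadamard boxes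
have exactly two legs and boundary nodes exactly one. -/
structure ZXDiagram (ι : Type) where
  Node : Type
  Edge : Type
  [fintypeNode : Fintype Node]
  [fintypeEdge : Fintype Edge]
  [decEqNode : DecidableEq Node]
  [decEqEdge : DecidableEq Edge]
  attach : Edge × Bool → Node ⊕ ι
  kind : Node → NodeKind
  phase : Node → ZMod 4
  hadamard_degree : ∀ v, kind v = NodeKind.H → Nat.card {h // attach h = Sum.inl v} = 2
  boundary_degree : ∀ i, ∃! h, attach h = Sum.inr i

attribute [instance] ZXDiagram.fintypeNode ZXDiagram.fintypeEdge ZXDiagram.decEqNode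
  ZXDiagram.decEqEdge

/-- The Pauli X matrix. -/
def pauliX : Matrix Bool Bool ℂ := fun a b => if a = b then 0 else 1

/-- The Pauli Z matrix. -/
def pauliZ : Matrix Bool Bool ℂ := fun a b => if a = b then (if a then -1 else 1) else 0

/-- Coordinates of the vectors `|0⟩`, `|1⟩`, `|+⟩`, `|-⟩`; `false` is the basis index 0. -/
def ketZero : Bool → ℂ := fun b => if b then 0 else 1

def ketOne : Bool → ℂ := fun b => if b then 1 else 0

noncomputable def ketPlus : Bool → ℂ := fun _ => 1 / (Real.sqrt 2 : ℂ)

noncomputable def ketMinus : Bool → ℂ :=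
  fun b => if b then -1 / (Real.sqrt 2 : ℂ) else 1 / (Real.sqrt 2 : ℂ)

namespace ZXDiagram

variable {ι κ : Type}

/-- An error is a finite set of edge flips. -/
abbrev Error (D : ZXDiagram ι) : Type := Finset (D.Edge × FlipKind)

open Classical in
/-- The weight of an error: the number of edges affected by it. -/
noncomputable def weight (D : ZXDiagram ι) (F : D.Error) : ℕ := (F.image Prod.fst).card

open Classical in
/-- The half-edges attached to a node. -/
noncomputable def legs (D : ZXDiagram ι) (v : D.Node) : Finset (D.Edge × Bool) :=
  Finset.univ.filter fun h => D.attach h = Sum.inl v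

open Classical in
/-- The entry of the tensor of the node `v` when its legs carry the basis labels `s`:
`|0…0⟩ + e^{iα} |1…1⟩` for a Z spider, `|+…+⟩ + e^{iα} |-…-⟩` for an X spider and
`|0⟩⟨+| + |1⟩⟨-|` for a Hadamard box. -/
noncomputable def nodeTensor (D : ZXDiagram ι) (v : D.Node) (s : D.Edge × Bool → Bool) : ℂ :=
  match D.kind v with
  | NodeKind.Z => (∏ h ∈ D.legs v, ketZero (s h)) +
      Complex.I ^ (D.phase v).val * ∏ h ∈ D.legs v, ketOne (s h)
  | NodeKind.X => (∏ h ∈ D.legs v, ketPlus (s h)) +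
      Complex.I ^ (D.phase v).val * ∏ h ∈ D.legs v, ketMinus (s h)
  | NodeKind.H =>
      if ∀ h ∈ D.legs v, s h = true then -1 / (Real.sqrt 2 : ℂ) else 1 / (Real.sqrt 2 : ℂ)

open Classical in
/-- The operator on the edge `e` after the flips of `F`: identity, X, Z, or their product. -/
noncomputable def edgeOperator (D : ZXDiagram ι) (F : D.Error) (e : D.Edge) :
    Matrix Bool Bool ℂ :=
  (if (e, FlipKind.X) ∈ F then pauliX else 1) * (if (e, FlipKind.Z) ∈ F then pauliZ else 1)

open Classical in
/-- The interpretation of the diagram `D + F`, by contraction of the tensor network. It is given by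
the coefficients, in the computational basis, of the linear map of the diagram with all
its boundary wires bent to outputs. The interpretation of `D` itself is `D.interp ∅`. -/
noncomputable def interp (D : ZXDiagram ι) (F : D.Error) : (ι → Bool) → ℂ := fun x =>
  ∑ s : D.Edge × Bool → Bool,
    (∏ v, D.nodeTensor v s) * (∏ e, D.edgeOperator F e (s (e, false)) (s (e, true))) *
      (if ∀ h i, D.attach h = Sum.inr i → s h = x i then 1 else 0)

end ZXDiagram

/-- Equality of interpretations. The calculus ignores nonzero global scalars. -/
def EqUpToScalar {ι : Type} (f g : (ι → Bool) → ℂ) : Prop := ∃ c : ℂ, c ≠ 0 ∧ f = c • g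

namespace ZXDiagram

variable {ι κ : Type}

/-- A trivial error does not change the interpretation. -/
def IsTrivial (D : ZXDiagram ι) (F : D.Error) : Prop := EqUpToScalar (D.interp F) (D.interp ∅)

/-- A detectable error makes the diagram zero. -/
def IsDetectable (D : ZXDiagram ι) (F : D.Error) : Prop := D.interp F = 0

/-- The ZX distance: the minimal weight of a non-trivial undetectable error (`⊤` if there is
none). -/
noncomputable def distance (D : ZXDiagram ι) : ℕ∞ :=
  ⨅ F ∈ {F : D.Error | ¬ D.IsTrivial F ∧ ¬ D.IsDetectable F}, (D.weight F : ℕ∞)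

end ZXDiagram

/-- A diagram that can serve as a side of a rewrite rule: every edge has at least one end
that is not a boundary node, i.e. there is no bare wire joining two boundary nodes. -/
structure ZXPattern (ι : Type) extends ZXDiagram ι where
  no_wire : ∀ e, ∃ b v, attach (e, b) = Sum.inl v

namespace ZXPattern

variable {ι κ : Type}

theorem exists_neighbour (P : ZXPattern ι) (i : ι) :
    ∃ v, ∃ e b, P.attach (e, b) = Sum.inr i ∧ P.attach (e, !b) = Sum.inl v := by
  obtain ⟨⟨e, b⟩, h, -⟩ := P.boundary_degree i
  obtain ⟨c, v, hv⟩ := P.no_wire e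
  refine ⟨v, e, b, h, ?_⟩
  rcases Bool.eq_or_eq_not c b with rfl | rfl
  · rw [h] at hv
    cases hv
  · exact hv

/-- The node at the other end of the boundary edge of `i`. -/
noncomputable def neighbour (P : ZXPattern ι) (i : ι) : P.Node := (P.exists_neighbour i).choose

theorem neighbour_spec (P : ZXPattern ι) (i : ι) :
    ∃ e b, P.attach (e, b) = Sum.inr i ∧ P.attach (e, !b) = Sum.inl (P.neighbour i) :=
  (P.exists_neighbour i).choose_spec

theorem neighbour_eq (P : ZXPattern ι) {i : ι} {e : P.Edge} {b : Bool} {v : P.Node}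
    (h : P.attach (e, b) = Sum.inr i) (h₂ : P.attach (e, !b) = Sum.inl v) :
    P.neighbour i = v := by
  obtain ⟨e₁, b₁, h₃, h₄⟩ := P.neighbour_spec i
  have := (P.boundary_degree i).unique h h₃
  simp only [Prod.mk.injEq] at this
  obtain ⟨rfl, rfl⟩ := this
  rw [h₂] at h₄
  exact (Sum.inl.inj h₄).symm

/-- The internal edges: no end is a boundary node. -/
abbrev InternalEdge (P : ZXPattern ι) : Type :=
  {e : P.Edge // ∀ b, (P.attach (e, b)).isLeft = true}

/-- The incidence map of `plug`. -/
noncomputable def plugAttach (C : ZXDiagram (ι ⊕ κ)) (P : ZXPattern ι) :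
    (C.Edge ⊕ P.InternalEdge) × Bool → (C.Node ⊕ P.Node) ⊕ κ
  | (Sum.inl e, b) =>
    match C.attach (e, b) with
    | Sum.inl v => Sum.inl (Sum.inl v)
    | Sum.inr (Sum.inl i) => Sum.inl (Sum.inr (P.neighbour i))
    | Sum.inr (Sum.inr k) => Sum.inr k
  | (Sum.inr e, b) => Sum.inl (Sum.inr ((P.attach (e.1, b)).getLeft (e.2 b)))

theorem plugAttach_inl_eq (C : ZXDiagram (ι ⊕ κ)) (P : ZXPattern ι) (h : C.Edge × Bool) :
    plugAttach C P (Sum.inl h.1, h.2) =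
      match C.attach h with
      | Sum.inl v => Sum.inl (Sum.inl v)
      | Sum.inr (Sum.inl i) => Sum.inl (Sum.inr (P.neighbour i))
      | Sum.inr (Sum.inr k) => Sum.inr k := rfl

theorem plugAttach_card_left (C : ZXDiagram (ι ⊕ κ)) (P : ZXPattern ι) (v : C.Node) :
    Nat.card {h // plugAttach C P h = Sum.inl (Sum.inl v)} =
      Nat.card {h // C.attach h = Sum.inl v} := by
  symm
  refine Nat.card_eq_of_bijective
    (fun h => ⟨(Sum.inl h.1.1, h.1.2), by rw [plugAttach_inl_eq, h.2]⟩) ⟨?_, ?_⟩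
  · rintro ⟨⟨e, b⟩, h⟩ ⟨⟨e', b'⟩, h'⟩ heq
    simpa using heq
  · rintro ⟨⟨e | e, b⟩, h⟩
    · refine ⟨⟨(e, b), ?_⟩, rfl⟩
      rw [plugAttach_inl_eq C P (e, b)] at h
      rcases hc : C.attach (e, b) with w | i | k <;> simp_all
    · simp [plugAttach] at h

theorem plugAttach_card_right (C : ZXDiagram (ι ⊕ κ)) (P : ZXPattern ι) (v : P.Node) :
    Nat.card {h // plugAttach C P h = Sum.inl (Sum.inr v)} =
      Nat.card {h // P.attach h = Sum.inl v} := by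
  symm
  choose port hport huniq using fun i : ι => C.boundary_degree (Sum.inl i)
  have key : ∀ h : {h // P.attach h = Sum.inl v},
      ∃ g : {h // plugAttach C P h = Sum.inl (Sum.inr v)},
        (∀ i, P.attach (h.1.1, !h.1.2) = Sum.inr i →
          g.1 = (Sum.inl (port i).1, (port i).2)) ∧
        (∀ w, P.attach (h.1.1, !h.1.2) = Sum.inl w → ∃ p, g.1 = (Sum.inr ⟨h.1.1, p⟩, h.1.2)) := by
    rintro ⟨⟨e, b⟩, h⟩
    rcases hc : P.attach (e, !b) with w | i
    · have p : ∀ c, (P.attach (e, c)).isLeft = true := by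
        intro c
        rcases Bool.eq_or_eq_not c b with rfl | rfl
        · simp [h]
        · simp [hc]
      exact ⟨⟨(Sum.inr ⟨e, p⟩, b), by simp [plugAttach, h]⟩, by simp, fun _ _ => ⟨p, rfl⟩⟩
    · refine ⟨⟨(Sum.inl (port i).1, (port i).2), ?_⟩, ?_, by simp⟩
      · have : P.neighbour i = v := P.neighbour_eq hc (by simpa using h)
        rw [plugAttach_inl_eq, hport]
        simp [this]
      · rintro j hj
        cases Sum.inr.inj hj
        rfl
  choose f hf₁ hf₂ using key
  refine Nat.card_eq_of_bijective f ⟨?_, ?_⟩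
  · rintro ⟨⟨e, b⟩, h⟩ ⟨⟨e', b'⟩, h'⟩ heq
    rcases hc : P.attach (e, !b) with w | i <;> rcases hc' : P.attach (e', !b') with w' | i'
    · obtain ⟨p, hp⟩ := hf₂ ⟨(e, b), h⟩ w hc
      obtain ⟨p', hp'⟩ := hf₂ ⟨(e', b'), h'⟩ w' hc'
      rw [heq, hp'] at hp
      simp at hp
      simp [hp]
    · obtain ⟨p, hp⟩ := hf₂ ⟨(e, b), h⟩ w hc
      have hp' := hf₁ ⟨(e', b'), h'⟩ i' hc'
      rw [heq, hp'] at hp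
      simp at hp
    · have hp := hf₁ ⟨(e, b), h⟩ i hc
      obtain ⟨p', hp'⟩ := hf₂ ⟨(e', b'), h'⟩ w' hc'
      rw [heq, hp'] at hp
      simp at hp
    · have hp := hf₁ ⟨(e, b), h⟩ i hc
      have hp' := hf₁ ⟨(e', b'), h'⟩ i' hc'
      rw [heq, hp'] at hp
      simp only [Prod.mk.injEq, Sum.inl.injEq] at hp
      have hpp : port i' = port i := Prod.ext hp.1 hp.2
      have hii : i' = i := by
        have := hport i
        rw [← hpp, hport i'] at this
        simpa using this
      subst hii
      have := (P.boundary_degree i').unique hc hc'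
      simpa using this
  · rintro ⟨⟨e | ⟨e, p⟩, b⟩, h⟩
    · have h₀ := h
      rw [plugAttach_inl_eq C P (e, b)] at h
      rcases hc : C.attach (e, b) with w | i | k
      · simp [hc] at h
      · simp only [hc, Sum.inl.injEq, Sum.inr.injEq] at h
        obtain ⟨e₁, b₁, h₁, h₂⟩ := P.neighbour_spec i
        refine ⟨⟨(e₁, !b₁), by rw [h₂, h]⟩, Subtype.ext ?_⟩
        rw [hf₁ _ i (by simpa using h₁)]
        rw [← huniq i _ hc]
      · simp [hc] at h
    · have hv : P.attach (e, b) = Sum.inl v := by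
        have h₁ : (P.attach (e, b)).getLeft (p b) = v := by simpa [plugAttach] using h
        rw [← h₁]
        simp
      obtain ⟨w, hw⟩ := Sum.isLeft_iff.mp (p !b)
      refine ⟨⟨(e, b), hv⟩, Subtype.ext ?_⟩
      obtain ⟨q, hq⟩ := hf₂ ⟨(e, b), hv⟩ w hw
      exact hq

theorem plugAttach_boundary (C : ZXDiagram (ι ⊕ κ)) (P : ZXPattern ι) (k : κ) :
    ∃! h, plugAttach C P h = Sum.inr k := by
  obtain ⟨h, hh, hu⟩ := C.boundary_degree (Sum.inr k)
  refine ⟨(Sum.inl h.1, h.2), by simp only [plugAttach_inl_eq, hh], ?_⟩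
  rintro ⟨e | e, b⟩ h'
  · rw [plugAttach_inl_eq C P (e, b)] at h'
    rcases hc : C.attach (e, b) with w | i | k'
    · simp [hc] at h'
    · simp [hc] at h'
    · simp only [hc, Sum.inr.injEq] at h'
      subst h'
      rw [← hu _ hc]
  · simp [plugAttach] at h'

/-- The diagram obtained by inserting `P` into the context `C`. A context is a diagram whose
boundary nodes are the ports `ι` of the hole together with the boundary `κ` of the whole diagram.
The boundary edge of `P` at `i` and the edge of `C` at the port `i` become one edge. An
edge of `C` may join two ports, a port and a boundary node of the whole diagram, and so on. -/
noncomputable abbrev plug (C : ZXDiagram (ι ⊕ κ)) (P : ZXPattern ι) : ZXDiagram κ where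
  Node := C.Node ⊕ P.Node
  Edge := C.Edge ⊕ P.InternalEdge
  attach := plugAttach C P
  kind := Sum.elim C.kind P.kind
  phase := Sum.elim C.phase P.phase
  hadamard_degree := by
    rintro (v | v) hv
    · rw [plugAttach_card_left]
      exact C.hadamard_degree v hv
    · rw [plugAttach_card_right]
      exact P.hadamard_degree v hv
  boundary_degree := plugAttach_boundary C P

/-- Replacing `P` by `Q` does not decrease the ZX distance of any diagram in which `P` occurs. -/
def DistanceNonDecreasing (P Q : ZXPattern ι) : Prop :=
  ∀ (κ : Type) (C : ZXDiagram (ι ⊕ κ)), (plug C P).distance ≤ (plug C Q).distance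

/-- `P → Q` is a distance-preserving rewrite: the two diagrams have the same interpretation and the
rewrite and its inverse are distance non-decreasing. -/
def DistancePreserving (P Q : ZXPattern ι) : Prop :=
  EqUpToScalar (P.interp ∅) (Q.interp ∅) ∧
    DistanceNonDecreasing P Q ∧ DistanceNonDecreasing Q P

end ZXPattern

/-- The phase-free Z spider with `k` legs. -/
abbrev zSpider (k : ℕ) : ZXPattern (Fin k) where
  Node := Unit
  Edge := Fin k
  attach := fun h => if h.2 then Sum.inr h.1 else Sum.inl ()
  kind := fun _ => NodeKind.Z
  phase := fun _ => 0
  hadamard_degree := fun _ hv => nomatch hv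
  boundary_degree := by
    intro i
    refine ⟨(i, true), by simp, ?_⟩
    rintro ⟨j, b⟩ h
    cases b <;> simp_all
  no_wire := fun e => ⟨false, (), by simp⟩

/-- The decomposition of the `(n + 1)`-legged Z spider, for even `n`, into phase-free Z spiders:
* outer spiders `inl i`, `i < n / 2`, with four legs: the boundary legs `2 i` and `2 i + 1` and one
  internal edge to each of the two hubs;
* the hub `inr false` with `n / 2` legs, one to each outer spider;
* the hub `inr true` with `n / 2 + 1` legs, one to each outer spider and the last boundary leg. -/
abbrev splitSpider (n : ℕ) : ZXPattern (Fin (n + 1)) where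
  Node := Fin (n / 2) ⊕ Bool
  Edge := Fin (n + 1) ⊕ Fin (n / 2) × Bool
  attach
    | (Sum.inl j, true) => Sum.inr j
    | (Sum.inl j, false) =>
      if h : j.val / 2 < n / 2 then Sum.inl (Sum.inl ⟨j.val / 2, h⟩)
      else Sum.inl (Sum.inr true)
    | (Sum.inr (i, _), false) => Sum.inl (Sum.inl i)
    | (Sum.inr (_, c), true) => Sum.inl (Sum.inr c)
  kind := fun _ => NodeKind.Z
  phase := fun _ => 0
  hadamard_degree := fun _ hv => nomatch hv
  boundary_degree := by
    intro i
    refine ⟨(Sum.inl i, true), rfl, ?_⟩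
    rintro ⟨j | ⟨j, c⟩, b⟩ h
    · cases b
      · by_cases hj : j.val / 2 < n / 2 <;> simp [hj] at h
      · simpa using h
    · cases b <;> simp at h
  no_wire := by
    rintro (j | ⟨j, c⟩)
    · by_cases hj : j.val / 2 < n / 2
      · exact ⟨false, Sum.inl ⟨j.val / 2, hj⟩, by simp [hj]⟩
      · exact ⟨false, Sum.inr true, by simp [hj]⟩
    · exact ⟨false, Sum.inl j, rfl⟩

/-! Edges that cross the boundary of a pattern are counted as edges of the context. An error on a
plugged diagram therefore splits into a context error and an error on the internal edges of the
pattern, and the interpretation is the contraction of the two parts (`interp_plug`). The single Z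
spider has no internal edge, so an error next to it can be copied verbatim next to the split spider;
this settles one direction.

For the other direction, Pauli operators on boundary legs can be absorbed by the context at the
price of one edge per leg (`exists_interp_pauli`). It is thus enough that an error on the internal
edges of the split spider either annihilates it or acts as Pauli operators on at most as many legs
of the single spider as the error has edges (`splitSpider.exists_pauli`).

Without errors all spiders carry the same label. With X flips, the outer spider `i` sees its two
hubs differ by the parity of the flips on its two edges. If these parities are not all equal,
nothing survives. If they are all even, an outer spider with a flip towards the second hub has both
internal edges flipped, which pays for flipping its two boundary legs. If they are all odd, every
outer spider has a flipped edge, so the weight is at least `n / 2`; since X on all legs fixes the Z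
spider, one may flip either the set of affected legs or its complement, and one of these has at most
`n / 2` elements. Finally, Z flips slide through Z spiders and merge into at most one Z on a leg of
choice, placed on a leg that is already paid for whenever there is one. -/

/-- The sign `(-1) ^ b`. -/
def boolSign (b : Bool) : ℂ := if b then -1 else 1

theorem boolSign_ne_zero (b : Bool) : boolSign b ≠ 0 := by cases b <;> simp [boolSign]

theorem boolSign_xor (a b : Bool) : boolSign (a ^^ b) = boolSign a * boolSign b := by
  cases a <;> cases b <;> simp [boolSign]

open Classical in
/-- Negation of the bits in `A`. -/
noncomputable def flipBits {ι : Type} (A : Finset ι) (x : ι → Bool) : ι → Bool :=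
  fun i => x i ^^ decide (i ∈ A)

theorem flipBits_flipBits {ι : Type} (A : Finset ι) (x : ι → Bool) :
    flipBits A (flipBits A x) = x := by
  funext i
  simp [flipBits]

/-- Negation of the bits in `A`, as a permutation. -/
noncomputable def flipBitsEquiv {ι : Type} (A : Finset ι) : Equiv.Perm (ι → Bool) where
  toFun := flipBits A
  invFun := flipBits A
  left_inv := flipBits_flipBits A
  right_inv := flipBits_flipBits A

/-! ### Absorbing Pauli operators on boundary legs into the error. -/

namespace ZXDiagram

variable {ι : Type} (D : ZXDiagram ι)

/-- The half-edge attached to a boundary node. -/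
noncomputable def boundaryHalf (i : ι) : D.Edge × Bool := (D.boundary_degree i).choose

theorem attach_boundaryHalf (i : ι) : D.attach (D.boundaryHalf i) = Sum.inr i :=
  (D.boundary_degree i).choose_spec.1

theorem eq_boundaryHalf {i : ι} {h : D.Edge × Bool} (hh : D.attach h = Sum.inr i) :
    h = D.boundaryHalf i :=
  (D.boundary_degree i).unique hh (D.attach_boundaryHalf i)

open Classical in
theorem edgeOperator_apply (F : D.Error) (e : D.Edge) (a b : Bool) :
    D.edgeOperator F e a b =
      if a = (b ^^ decide ((e, FlipKind.X) ∈ F)) then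
        boolSign (b && decide ((e, FlipKind.Z) ∈ F)) else 0 := by
  unfold edgeOperator
  by_cases hX : (e, FlipKind.X) ∈ F <;> by_cases hZ : (e, FlipKind.Z) ∈ F <;>
    cases a <;> cases b <;>
    simp [hX, hZ, pauliX, pauliZ, boolSign, Matrix.mul_apply, Matrix.one_apply]

theorem nodeTensor_congr (v : D.Node) {s s' : D.Edge × Bool → Bool}
    (h : ∀ g, D.attach g = Sum.inl v → s g = s' g) : D.nodeTensor v s = D.nodeTensor v s' := by
  have hl : ∀ g ∈ D.legs v, s g = s' g := fun g hg => h g (by simpa [legs] using hg)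
  have hp : ∀ f : Bool → ℂ, ∏ g ∈ D.legs v, f (s g) = ∏ g ∈ D.legs v, f (s' g) :=
    fun f => Finset.prod_congr rfl fun g hg => by rw [hl g hg]
  have hH : (∀ g ∈ D.legs v, s g = true) ↔ ∀ g ∈ D.legs v, s' g = true :=
    forall₂_congr fun g hg => by rw [hl g hg]
  unfold nodeTensor
  cases D.kind v <;> simp only [hp, hH]

-- Toggling X on the boundary edge amounts to negating the label of the boundary half-edge. The
-- conclusion bounds the set of affected edges rather than the weight, so that an X and a Z on the
-- same leg are later charged only once.
open Classical in
theorem exists_interp_flip (F : D.Error) (i : ι) :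
    ∃ F' : D.Error, F'.image Prod.fst ⊆ insert (D.boundaryHalf i).1 (F.image Prod.fst) ∧
      ∃ c : ℂ, c ≠ 0 ∧ ∀ x, D.interp F' x = c * D.interp F (flipBits {i} x) := by
  set e := (D.boundaryHalf i).1
  set b := (D.boundaryHalf i).2
  have heb : (e, b) = D.boundaryHalf i := rfl
  -- The operator on an edge is X times Z, so Z reads the label of the `true` end. Negating that
  -- label costs a sign only if `b` is `true` and Z is present.
  refine ⟨symmDiff F {(e, FlipKind.X)}, ?_,
    boolSign (b && decide ((e, FlipKind.Z) ∈ F)), boolSign_ne_zero _, fun x => ?_⟩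
  · intro e' h
    simp only [Finset.mem_image, Finset.mem_symmDiff, Finset.mem_singleton] at h
    obtain ⟨p, ⟨hp, -⟩ | ⟨rfl, -⟩, rfl⟩ := h
    · exact Finset.mem_insert_of_mem (Finset.mem_image_of_mem _ hp)
    · exact Finset.mem_insert_self _ _
  unfold interp
  rw [Finset.mul_sum]
  refine Fintype.sum_equiv (flipBitsEquiv {(e, b)}) _ _ fun s => ?_
  have h₁ : ∀ v, D.nodeTensor v (flipBits {(e, b)} s) = D.nodeTensor v s := fun v =>
    D.nodeTensor_congr v fun g hg => by
      have : g ≠ (e, b) := by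
        rintro rfl
        rw [heb, attach_boundaryHalf] at hg
        cases hg
      simp [flipBits, this]
  have h₂ : (∀ h j, D.attach h = Sum.inr j → flipBits {(e, b)} s h = flipBits {i} x j) ↔
      ∀ h j, D.attach h = Sum.inr j → s h = x j := by
    refine forall_congr' fun h => forall_congr' fun j => imp_congr_right fun hh => ?_
    have : h = (e, b) ↔ j = i := by
      constructor
      · rintro rfl
        rw [heb, attach_boundaryHalf] at hh
        exact (Sum.inr.inj hh).symm
      · rintro rfl
        exact D.eq_boundaryHalf hh
    simp [flipBits, this]
  have h₃ : ∏ e', D.edgeOperator (symmDiff F {(e, FlipKind.X)}) e' (s (e', false)) (s (e', true)) =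
      boolSign (b && decide ((e, FlipKind.Z) ∈ F)) *
      ∏ e', D.edgeOperator F e' (flipBits {(e, b)} s (e', false))
        (flipBits {(e, b)} s (e', true)) := by
    have : boolSign (b && decide ((e, FlipKind.Z) ∈ F)) =
      ∏ e', if e' = e then boolSign (b && decide ((e, FlipKind.Z) ∈ F)) else 1 := by simp
    rw [this, ← Finset.prod_mul_distrib]
    refine Finset.prod_congr rfl fun e' _ => ?_
    by_cases hee : e' = e
    · rw [hee]
      simp only [edgeOperator_apply, flipBits, Finset.mem_symmDiff, Finset.mem_singleton]
      by_cases hX : (e, FlipKind.X) ∈ F <;> by_cases hZ : (e, FlipKind.Z) ∈ F <;>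
        cases s (e, false) <;> cases s (e, true) <;> cases b <;> simp [hX, hZ, boolSign]
    · simp [edgeOperator_apply, flipBits, Finset.mem_symmDiff, hee]
  change _ = _ * ((∏ v, D.nodeTensor v (flipBits {(e, b)} s)) * (∏ e', D.edgeOperator F e'
    (flipBits {(e, b)} s (e', false)) (flipBits {(e, b)} s (e', true))) *
    (if ∀ h j, D.attach h = Sum.inr j → flipBits {(e, b)} s h = flipBits {i} x j then 1 else 0))
  simp only [h₁, h₂, h₃]
  ring

open Classical in
theorem exists_interp_sign (F : D.Error) (i : ι) :
    ∃ F' : D.Error, F'.image Prod.fst ⊆ insert (D.boundaryHalf i).1 (F.image Prod.fst) ∧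
      ∃ c : ℂ, c ≠ 0 ∧ ∀ x, D.interp F' x = c * (boolSign (x i) * D.interp F x) := by
  set e := (D.boundaryHalf i).1
  set b := (D.boundaryHalf i).2
  have heb : (e, b) = D.boundaryHalf i := rfl
  -- If the boundary half-edge is the `false` end, then the new Z reads the boundary value only
  -- after a possible X, whence the sign.
  refine ⟨symmDiff F {(e, FlipKind.Z)}, ?_,
    boolSign (!b && decide ((e, FlipKind.X) ∈ F)), boolSign_ne_zero _, fun x => ?_⟩
  · intro e' h
    simp only [Finset.mem_image, Finset.mem_symmDiff, Finset.mem_singleton] at h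
    obtain ⟨p, ⟨hp, -⟩ | ⟨rfl, -⟩, rfl⟩ := h
    · exact Finset.mem_insert_of_mem (Finset.mem_image_of_mem _ hp)
    · exact Finset.mem_insert_self _ _
  unfold interp
  rw [Finset.mul_sum, Finset.mul_sum]
  refine Finset.sum_congr rfl fun s _ => ?_
  split_ifs with hx
  swap
  · simp
  have hxi : s (e, b) = x i := hx _ _ (D.attach_boundaryHalf i)
  have h₃ : ∏ e', D.edgeOperator (symmDiff F {(e, FlipKind.Z)}) e' (s (e', false)) (s (e', true)) =
      boolSign (!b && decide ((e, FlipKind.X) ∈ F)) * boolSign (x i) *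
      ∏ e', D.edgeOperator F e' (s (e', false)) (s (e', true)) := by
    have : boolSign (!b && decide ((e, FlipKind.X) ∈ F)) * boolSign (x i) =
      ∏ e', if e' = e then boolSign (!b && decide ((e, FlipKind.X) ∈ F)) * boolSign (x i)
        else 1 := by simp
    rw [this, ← Finset.prod_mul_distrib]
    refine Finset.prod_congr rfl fun e' _ => ?_
    by_cases hee : e' = e
    · rw [hee, ← hxi]
      simp only [edgeOperator_apply, Finset.mem_symmDiff, Finset.mem_singleton]
      by_cases hX : (e, FlipKind.X) ∈ F <;> by_cases hZ : (e, FlipKind.Z) ∈ F <;>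
        cases h0 : s (e, false) <;> cases h1 : s (e, true) <;> cases b <;>
        simp [hX, hZ, boolSign, h0, h1]
    · simp [edgeOperator_apply, Finset.mem_symmDiff, hee]
  simp only [h₃]
  ring

open Classical in
/-- Pauli operators on boundary legs can be absorbed into the error, at the cost of one edge for
every affected leg. -/
theorem exists_interp_pauli (F : D.Error) (A B : Finset ι) :
    ∃ F' : D.Error, D.weight F' ≤ D.weight F + (A ∪ B).card ∧
      ∃ c : ℂ, c ≠ 0 ∧
        ∀ x, D.interp F' x = c * ((∏ j ∈ B, boolSign (x j)) * D.interp F (flipBits A x)) := by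
  obtain ⟨F₁, hF₁, c₁, hc₁, h₁⟩ : ∃ F' : D.Error,
      F'.image Prod.fst ⊆ F.image Prod.fst ∪ A.image (fun i => (D.boundaryHalf i).1) ∧
      ∃ c : ℂ, c ≠ 0 ∧ ∀ x, D.interp F' x = c * D.interp F (flipBits A x) := by
    induction A using Finset.induction_on with
    | empty =>
      refine ⟨F, by simp, 1, one_ne_zero, fun x => ?_⟩
      have : flipBits ∅ x = x := by
        funext j
        simp [flipBits]
      rw [this, one_mul]
    | insert i A hi ih =>
      obtain ⟨F₁, hF₁, c₁, hc₁, h₁⟩ := ih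
      obtain ⟨F₂, hF₂, c₂, hc₂, h₂⟩ := D.exists_interp_flip F₁ i
      refine ⟨F₂, ?_, c₂ * c₁, mul_ne_zero hc₂ hc₁, fun x => ?_⟩
      · rw [Finset.image_insert, Finset.union_insert]
        exact hF₂.trans (Finset.insert_subset_insert _ hF₁)
      · have : flipBits A (flipBits {i} x) = flipBits (insert i A) x := by
          funext j
          by_cases hj : j = i
          · subst hj
            simp [flipBits, hi]
          · simp [flipBits, hj]
        rw [h₂, h₁, this, mul_assoc]
  obtain ⟨F₂, hF₂, c₂, hc₂, h₂⟩ : ∃ F' : D.Error,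
      F'.image Prod.fst ⊆ F₁.image Prod.fst ∪ B.image (fun i => (D.boundaryHalf i).1) ∧
      ∃ c : ℂ, c ≠ 0 ∧
        ∀ x, D.interp F' x = c * ((∏ j ∈ B, boolSign (x j)) * D.interp F₁ x) := by
    induction B using Finset.induction_on with
    | empty => exact ⟨F₁, by simp, 1, one_ne_zero, fun x => by simp⟩
    | insert i B hi ih =>
      obtain ⟨F₂, hF₂, c₂, hc₂, h₂⟩ := ih
      obtain ⟨F₃, hF₃, c₃, hc₃, h₃⟩ := D.exists_interp_sign F₂ i
      refine ⟨F₃, ?_, c₃ * c₂, mul_ne_zero hc₃ hc₂, fun x => ?_⟩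
      · rw [Finset.image_insert, Finset.union_insert]
        exact hF₃.trans (Finset.insert_subset_insert _ hF₂)
      · rw [h₃, h₂, Finset.prod_insert hi]
        ring
  refine ⟨F₂, ?_, c₂ * c₁, mul_ne_zero hc₂ hc₁, fun x => by rw [h₂, h₁]; ring⟩
  have hsub : F₂.image Prod.fst ⊆
      F.image Prod.fst ∪ (A ∪ B).image (fun i => (D.boundaryHalf i).1) := by
    rw [Finset.image_union, ← Finset.union_assoc]
    exact hF₂.trans (Finset.union_subset_union_left hF₁)
  unfold weight
  exact (Finset.card_le_card hsub).trans ((Finset.card_union_le _ _).trans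
    (Nat.add_le_add_left Finset.card_image_le _))

end ZXDiagram

/-! ### Node tensors and the contraction of phase-free Z diagrams. -/

namespace ZXDiagram

variable {ι κ : Type}

open Classical in
/-- Two nodes of the same kind and phase have the same tensor entry if their legs correspond and
carry the same labels. -/
theorem nodeTensor_eq_of_legs {D : ZXDiagram ι} {D' : ZXDiagram κ} {v : D.Node} {v' : D'.Node}
    (hk : D'.kind v' = D.kind v) (hp : D'.phase v' = D.phase v)
    {s : D.Edge × Bool → Bool} {s' : D'.Edge × Bool → Bool} (φ : D.Edge × Bool → D'.Edge × Bool)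
    (hφ : Set.InjOn φ (D.legs v)) (hl : D'.legs v' = (D.legs v).image φ)
    (hs : ∀ h ∈ D.legs v, s' (φ h) = s h) : D'.nodeTensor v' s' = D.nodeTensor v s := by
  have hprod : ∀ f : Bool → ℂ, ∏ g ∈ D'.legs v', f (s' g) = ∏ g ∈ D.legs v, f (s g) := fun f => by
    rw [hl, Finset.prod_image hφ]
    exact Finset.prod_congr rfl fun g hg => by rw [hs g hg]
  have hH : (∀ g ∈ D'.legs v', s' g = true) ↔ ∀ g ∈ D.legs v, s g = true := by
    rw [hl, Finset.forall_mem_image]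
    exact forall₂_congr fun g hg => by rw [hs g hg]
  unfold nodeTensor
  rw [hk, hp]
  cases D.kind v <;> simp only [hprod, hH]

theorem nodeTensor_of_phaseFree_Z (D : ZXDiagram ι) {v : D.Node} (hk : D.kind v = NodeKind.Z)
    (hp : D.phase v = 0) (s : D.Edge × Bool → Bool) :
    D.nodeTensor v s = ∑ b, ∏ h ∈ D.legs v, if s h = b then (1 : ℂ) else 0 := by
  have h0 : ∀ h, ketZero (s h) = if s h = false then 1 else 0 := fun h => by
    cases s h <;> simp [ketZero]
  have h1 : ∀ h, ketOne (s h) = if s h = true then 1 else 0 := fun h => by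
    cases s h <;> simp [ketOne]
  simp only [nodeTensor, hk, hp, h0, h1, Fintype.sum_bool, ZMod.val_zero, pow_zero, one_mul]
  exact add_comm _ _

/-- In a diagram of phase-free Z spiders the contraction is a sum over one label for every
spider. -/
theorem interp_of_phaseFree_Z (D : ZXDiagram ι) (hk : ∀ v, D.kind v = NodeKind.Z)
    (hp : ∀ v, D.phase v = 0) (F : D.Error) (x : ι → Bool) :
    D.interp F x = ∑ t : D.Node → Bool, ∏ e, D.edgeOperator F e
      (Sum.elim t x (D.attach (e, false))) (Sum.elim t x (D.attach (e, true))) := by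
  classical
  unfold interp
  have hnode : ∀ s, ∏ v, D.nodeTensor v s =
      ∑ t : D.Node → Bool, ∏ v, ∏ h ∈ D.legs v, if s h = t v then (1 : ℂ) else 0 := fun s => by
    rw [Finset.prod_congr rfl fun v _ => D.nodeTensor_of_phaseFree_Z (hk v) (hp v) s,
      Finset.prod_univ_sum, Fintype.piFinset_univ]
  simp only [hnode, Finset.sum_mul]
  rw [Finset.sum_comm]
  refine Finset.sum_congr rfl fun t _ => ?_
  -- Once the spider labels `t` are fixed, every half-edge must carry the label of its vertex, so
  -- one labelling survives.
  rw [Finset.sum_eq_single fun h => Sum.elim t x (D.attach h)]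
  · have h₁ : ∏ v, ∏ h ∈ D.legs v,
        (if Sum.elim t x (D.attach h) = t v then (1 : ℂ) else 0) = 1 :=
      Finset.prod_eq_one fun v _ => Finset.prod_eq_one fun h hh => by
        have : D.attach h = Sum.inl v := by simpa [legs] using hh
        simp [this]
    have h₂ : ∀ h i, D.attach h = Sum.inr i → Sum.elim t x (D.attach h) = x i := fun h i hh => by
      simp [hh]
    rw [h₁, if_pos h₂, one_mul, mul_one]
  · intro s _ hs
    obtain ⟨h, hh⟩ := Function.ne_iff.mp hs
    rcases ha : D.attach h with v | i
    · have : ∏ v, ∏ h ∈ D.legs v, (if s h = t v then (1 : ℂ) else 0) = 0 :=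
        Finset.prod_eq_zero (Finset.mem_univ v) <|
          Finset.prod_eq_zero (i := h) (by simpa [legs] using ha) <| by
            rw [if_neg]
            simpa [ha] using hh
      rw [this]
      simp
    · rw [if_neg, mul_zero]
      intro hc
      exact hh (by simp [ha, hc h i ha])
  · simp

end ZXDiagram

/-! ### Splitting errors and node tensors of a plugged diagram. -/

namespace ZXPattern

variable {ι κ : Type}

theorem exists_boundaryIndex (P : ZXPattern ι) {e : P.Edge}
    (he : ¬ ∀ b, (P.attach (e, b)).isLeft = true) : ∃ i b, P.attach (e, b) = Sum.inr i := by
  push Not at he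
  obtain ⟨b, hb⟩ := he
  rcases h : P.attach (e, b) with v | i
  · simp [h] at hb
  · exact ⟨i, b, h⟩

/-- The boundary node at the end of an edge that is not internal. -/
noncomputable def boundaryIndex (P : ZXPattern ι) (e : P.Edge)
    (he : ¬ ∀ b, (P.attach (e, b)).isLeft = true) : ι :=
  (P.exists_boundaryIndex he).choose

theorem boundaryIndex_eq (P : ZXPattern ι) {e : P.Edge}
    (he : ¬ ∀ b, (P.attach (e, b)).isLeft = true) {b : Bool} {i : ι}
    (h : P.attach (e, b) = Sum.inr i) : P.boundaryIndex e he = i := by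
  obtain ⟨c, hc⟩ := (P.exists_boundaryIndex he).choose_spec
  obtain ⟨d, v, hd⟩ := P.no_wire e
  have hbd : b ≠ d := by
    rintro rfl
    rw [h] at hd
    cases hd
  have hcd : c ≠ d := by
    rintro rfl
    rw [hc] at hd
    cases hd
  have : b = c := (Bool.eq_not.mpr hbd).trans (Bool.eq_not.mpr hcd).symm
  subst this
  rw [h] at hc
  exact (Sum.inr.inj hc).symm

theorem attach_not_of_not_internal (P : ZXPattern ι) {e : P.Edge}
    (he : ¬ ∀ b, (P.attach (e, b)).isLeft = true) {b : Bool} {v : P.Node}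
    (h : P.attach (e, b) = Sum.inl v) : P.attach (e, !b) = Sum.inr (P.boundaryIndex e he) := by
  obtain ⟨c, hc⟩ := (P.exists_boundaryIndex he).choose_spec
  have : c = !b := by
    rcases Bool.eq_or_eq_not c b with rfl | rfl
    · rw [h] at hc
      cases hc
    · rfl
  rw [← this, hc]
  rfl

/-- The part of an error on a plugged diagram that lies on the edges of the context. -/
noncomputable def contextError (C : ZXDiagram (ι ⊕ κ)) (P : ZXPattern ι)
    (F : (plug C P).Error) : C.Error :=
  F.preimage (fun p : C.Edge × FlipKind => ((Sum.inl p.1 : C.Edge ⊕ P.InternalEdge), p.2))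
    fun p _ q _ h => by
      simp only [Prod.mk.injEq, Sum.inl.injEq] at h
      exact Prod.ext h.1 h.2

/-- The part of an error on a plugged diagram that lies on the internal edges of the pattern. -/
noncomputable def patternError (C : ZXDiagram (ι ⊕ κ)) (P : ZXPattern ι)
    (F : (plug C P).Error) : P.Error :=
  (F.preimage (fun p : P.InternalEdge × FlipKind => ((Sum.inr p.1 : C.Edge ⊕ P.InternalEdge), p.2))
    fun p _ q _ h => by
      simp only [Prod.mk.injEq, Sum.inr.injEq] at h
      exact Prod.ext h.1 h.2).map
    ⟨fun p => (p.1.1, p.2), fun p q h => by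
      simp only [Prod.mk.injEq] at h
      exact Prod.ext (Subtype.ext h.1) h.2⟩

theorem mem_contextError {C : ZXDiagram (ι ⊕ κ)} {P : ZXPattern ι} {F : (plug C P).Error}
    {e : C.Edge} {t : FlipKind} : (e, t) ∈ contextError C P F ↔ (Sum.inl e, t) ∈ F :=
  Finset.mem_preimage

theorem mem_patternError {C : ZXDiagram (ι ⊕ κ)} {P : ZXPattern ι} {F : (plug C P).Error}
    {e : P.Edge} {t : FlipKind} :
    (e, t) ∈ patternError C P F ↔ ∃ he, (Sum.inr (⟨e, he⟩ : P.InternalEdge), t) ∈ F := by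
  constructor
  · intro h
    obtain ⟨⟨⟨e', he'⟩, t'⟩, h₁, h₂⟩ := Finset.mem_map.mp h
    obtain ⟨rfl, rfl⟩ := Prod.mk.inj h₂
    have h₃ := Finset.mem_preimage.mp h₁
    exact ⟨he', h₃⟩
  · rintro ⟨he, h⟩
    exact Finset.mem_map.mpr ⟨(⟨e, he⟩, t), Finset.mem_preimage.mpr h, rfl⟩

/-- The two parts live on disjoint sets of edges, so no edge is counted twice. -/
theorem weight_contextError_add_weight_patternError_le (C : ZXDiagram (ι ⊕ κ)) (P : ZXPattern ι)
    (F : (plug C P).Error) :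
    C.weight (contextError C P F) + P.weight (patternError C P F) ≤ (plug C P).weight F := by
  classical
  unfold ZXDiagram.weight
  rw [← Finset.card_toLeft_add_card_toRight (u := F.image Prod.fst)]
  refine Nat.add_le_add (Finset.card_le_card ?_) ?_
  · intro e he
    obtain ⟨⟨e', t⟩, h, rfl⟩ := Finset.mem_image.mp he
    exact Finset.mem_toLeft.mpr (Finset.mem_image_of_mem Prod.fst (mem_contextError.mp h))
  · refine le_trans (Finset.card_le_card (t := (Finset.toRight (F.image Prod.fst)).image
      Subtype.val) ?_) Finset.card_image_le
    intro e he
    obtain ⟨⟨e', t⟩, h, rfl⟩ := Finset.mem_image.mp he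
    obtain ⟨hi, h'⟩ := mem_patternError.mp h
    exact Finset.mem_image.mpr
      ⟨⟨e', hi⟩, Finset.mem_toRight.mpr (Finset.mem_image_of_mem Prod.fst h'), rfl⟩

open Classical in
/-- The labels of the half-edges of a pattern that are induced by labels of the half-edges of a
plugged diagram. -/
noncomputable def patternLabels (C : ZXDiagram (ι ⊕ κ)) (P : ZXPattern ι)
    (s : (plug C P).Edge × Bool → Bool) (h : P.Edge × Bool) : Bool :=
  if he : ∀ b, (P.attach (h.1, b)).isLeft = true then s (Sum.inr ⟨h.1, he⟩, h.2)
  else s (Sum.inl (C.boundaryHalf (Sum.inl (P.boundaryIndex h.1 he))).1,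
    (C.boundaryHalf (Sum.inl (P.boundaryIndex h.1 he))).2)

theorem nodeTensor_plug_inl (C : ZXDiagram (ι ⊕ κ)) (P : ZXPattern ι) (v : C.Node)
    (s : (plug C P).Edge × Bool → Bool) :
    (plug C P).nodeTensor (Sum.inl v) s = C.nodeTensor v fun h => s (Sum.inl h.1, h.2) := by
  classical
  refine ZXDiagram.nodeTensor_eq_of_legs (D := C) (D' := plug C P) rfl rfl
    (fun h => (Sum.inl h.1, h.2)) ?_ ?_ fun _ _ => rfl
  · intro h _ h' _ heq
    simp only [Prod.mk.injEq, Sum.inl.injEq] at heq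
    exact Prod.ext heq.1 heq.2
  · ext ⟨e | e, b⟩
    · simp only [ZXDiagram.legs, Finset.mem_filter, Finset.mem_univ, true_and, Finset.mem_image,
        Prod.mk.injEq, Sum.inl.injEq, Prod.exists, exists_eq_right_right, exists_eq_right]
      rw [plugAttach_inl_eq C P (e, b)]
      rcases hc : C.attach (e, b) with w | i | k <;> simp
    · simp only [ZXDiagram.legs, Finset.mem_filter, Finset.mem_univ, true_and, Finset.mem_image]
      constructor
      · intro h
        cases Sum.inl.inj h
      · rintro ⟨h, -, hh⟩
        cases (Prod.mk.inj hh).1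

/-- Legs on internal edges keep their identity, and a leg on a boundary edge becomes the half-edge
of the context at the corresponding port. This correspondence is injective because each boundary
node has a single half-edge. -/
theorem nodeTensor_plug_inr (C : ZXDiagram (ι ⊕ κ)) (P : ZXPattern ι) (v : P.Node)
    (s : (plug C P).Edge × Bool → Bool) :
    (plug C P).nodeTensor (Sum.inr v) s = P.nodeTensor v (patternLabels C P s) := by
  classical
  have hmem : ∀ {h : P.Edge × Bool}, h ∈ P.legs v ↔ P.attach h = Sum.inl v := by
    simp [ZXDiagram.legs]
  refine ZXDiagram.nodeTensor_eq_of_legs (D := P.toZXDiagram) (D' := plug C P) rfl rfl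
    (fun h => if he : ∀ b, (P.attach (h.1, b)).isLeft = true then (Sum.inr ⟨h.1, he⟩, h.2)
      else (Sum.inl (C.boundaryHalf (Sum.inl (P.boundaryIndex h.1 he))).1,
        (C.boundaryHalf (Sum.inl (P.boundaryIndex h.1 he))).2)) ?_ ?_ ?_
  · rintro ⟨e, b⟩ h ⟨e', b'⟩ h' heq
    have h := hmem.mp h
    have h' := hmem.mp h'
    by_cases he : ∀ b, (P.attach (e, b)).isLeft = true <;>
      by_cases he' : ∀ b, (P.attach (e', b)).isLeft = true
    · simpa [he, he'] using heq
    · dsimp only at heq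
      rw [dif_pos he, dif_neg he'] at heq
      cases (Prod.mk.inj heq).1
    · dsimp only at heq
      rw [dif_neg he, dif_pos he'] at heq
      cases (Prod.mk.inj heq).1
    · dsimp only at heq
      rw [dif_neg he, dif_neg he', Prod.mk.injEq, Sum.inl.injEq] at heq
      have hi := C.attach_boundaryHalf (Sum.inl (P.boundaryIndex e he))
      rw [Prod.ext heq.1 heq.2, C.attach_boundaryHalf] at hi
      have hi : P.boundaryIndex e' he' = P.boundaryIndex e he := by simpa using hi
      have h₁ := P.attach_not_of_not_internal he h
      have h₂ := P.attach_not_of_not_internal he' h'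
      rw [hi] at h₂
      simpa using (P.boundary_degree _).unique h₁ h₂
  · ext ⟨e | ⟨e, he⟩, b⟩
    · simp only [ZXDiagram.legs, Finset.mem_filter, Finset.mem_univ, true_and, Finset.mem_image]
      rw [plugAttach_inl_eq C P (e, b)]
      constructor
      · intro h
        rcases hc : C.attach (e, b) with w | i | k
        · simp [hc] at h
        · simp only [hc, Sum.inl.injEq, Sum.inr.injEq] at h
          obtain ⟨e₁, b₁, h₁, h₂⟩ := P.neighbour_spec i
          have he₁ : ¬ ∀ b, (P.attach (e₁, b)).isLeft = true := fun h' => by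
            simpa [h₁] using h' b₁
          refine ⟨(e₁, !b₁), by rw [h₂, h], ?_⟩
          rw [dif_neg he₁, P.boundaryIndex_eq he₁ h₁, ← C.eq_boundaryHalf hc]
        · simp [hc] at h
      · rintro ⟨⟨e₁, b₁⟩, h₁, h₂⟩
        by_cases he₁ : ∀ b, (P.attach (e₁, b)).isLeft = true
        · simp [he₁] at h₂
        · rw [dif_neg he₁, Prod.mk.injEq, Sum.inl.injEq] at h₂
          have h₄ : C.boundaryHalf (Sum.inl (P.boundaryIndex e₁ he₁)) = (e, b) :=
            Prod.ext h₂.1 h₂.2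
          rw [← h₄, C.attach_boundaryHalf]
          have h₃ := P.attach_not_of_not_internal he₁ h₁
          change Sum.inl (Sum.inr (P.neighbour _)) = _
          rw [P.neighbour_eq h₃ (by simpa using h₁)]
    · have ha : ((plug C P).attach (Sum.inr ⟨e, he⟩, b) = Sum.inl (Sum.inr v)) ↔
          P.attach (e, b) = Sum.inl v := by
        change Sum.inl (Sum.inr ((P.attach (e, b)).getLeft (he b))) = _ ↔ _
        rw [Sum.inl.injEq, Sum.inr.injEq, Sum.getLeft_eq_iff]
      simp only [ZXDiagram.legs, Finset.mem_filter, Finset.mem_univ, true_and, Finset.mem_image]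
      rw [ha]
      constructor
      · exact fun h => ⟨(e, b), h, dif_pos he⟩
      · rintro ⟨⟨e₁, b₁⟩, h₁, h₂⟩
        by_cases he₁ : ∀ b, (P.attach (e₁, b)).isLeft = true
        · rw [dif_pos he₁] at h₂
          simp only [Prod.mk.injEq, Sum.inr.injEq, Subtype.mk.injEq] at h₂
          rw [← h₂.1, ← h₂.2, h₁]
        · rw [dif_neg he₁] at h₂
          cases (Prod.mk.inj h₂).1
  · intro h _
    unfold patternLabels
    split_ifs <;> rfl

end ZXPattern

/-! ### The interpretation of a plugged diagram as a contraction. -/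

namespace ZXPattern

variable {ι κ : Type}

open Classical in
theorem prod_edgeOperator_plug (C : ZXDiagram (ι ⊕ κ)) (P : ZXPattern ι) (F : (plug C P).Error)
    (s : (plug C P).Edge × Bool → Bool) :
    ∏ e, (plug C P).edgeOperator F e (s (e, false)) (s (e, true)) =
      (∏ e, C.edgeOperator (contextError C P F) e (s (Sum.inl e, false)) (s (Sum.inl e, true))) *
      ∏ e, P.edgeOperator (patternError C P F) e (patternLabels C P s (e, false))
        (patternLabels C P s (e, true)) := by
  have hC : ∀ e : C.Edge, (plug C P).edgeOperator F (Sum.inl e) =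
      C.edgeOperator (contextError C P F) e := fun e => by
    ext a b
    simp [ZXDiagram.edgeOperator_apply, mem_contextError]
  have hP : ∀ e : P.InternalEdge, (plug C P).edgeOperator F (Sum.inr e) =
      P.edgeOperator (patternError C P F) e.1 := fun e => by
    ext a b
    simp only [ZXDiagram.edgeOperator_apply, mem_patternError, e.2,
      exists_prop_of_true, implies_true]
  rw [Fintype.prod_sum_type]
  congr 1
  · exact Finset.prod_congr rfl fun e _ => by rw [hC]
  · rw [← Fintype.prod_subtype_mul_prod_subtype fun e => ∀ b, (P.attach (e, b)).isLeft = true]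
    rw [Finset.prod_congr (s₂ := (Finset.univ : Finset {e : P.Edge // ¬ _})) rfl fun e _ => ?_,
      Finset.prod_const_one, mul_one]
    · refine Finset.prod_congr ?_ fun e _ => ?_
      · ext
        simp
      · rw [hP, patternLabels, patternLabels, dif_pos e.2, dif_pos e.2]
    -- A boundary edge of the pattern carries no flip and gets the port label at both ends, so its
    -- factor is 1.
    · have hn : ∀ t, (e.1, t) ∉ patternError C P F := fun t h => e.2 (mem_patternError.mp h).1
      rw [patternLabels, patternLabels, dif_neg e.2, dif_neg e.2]
      simp [ZXDiagram.edgeOperator_apply, hn, boolSign]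

/-- The interpretation of a plugged diagram is the contraction of the interpretations of the
context and of the pattern. -/
theorem interp_plug [Fintype ι] [DecidableEq ι] (C : ZXDiagram (ι ⊕ κ)) (P : ZXPattern ι)
    (F : (plug C P).Error) (y : κ → Bool) :
    (plug C P).interp F y = ∑ z : ι → Bool,
      C.interp (contextError C P F) (Sum.elim z y) * P.interp (patternError C P F) z := by
  classical
  unfold ZXDiagram.interp
  simp only [Finset.sum_mul_sum]
  simp only [← Fintype.sum_prod_type']
  -- A labelling of the plugged diagram determines port values and labellings of both parts. Triples
  -- outside the image contribute zero: a nonzero term makes both parts agree with `z` at the ports,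
  -- and the flip-free boundary edges of the pattern then force the triple to be glued from one
  -- labelling.
  refine Finset.sum_of_injOn (fun s => (fun i => s (Sum.inl (C.boundaryHalf (Sum.inl i)).1,
    (C.boundaryHalf (Sum.inl i)).2), fun h => s (Sum.inl h.1, h.2), patternLabels C P s))
    ?_ (fun _ _ => Finset.mem_coe.mpr (Finset.mem_univ _)) ?_ ?_
  · intro s _ s' _ h
    simp only [Prod.mk.injEq] at h
    funext g
    obtain ⟨e | e, b⟩ := g
    · exact congrFun h.2.1 (e, b)
    · have := congrFun h.2.2 (e.1, b)
      rwa [patternLabels, patternLabels, dif_pos e.2, dif_pos e.2] at this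
  · rintro ⟨z, sC, sP⟩ - hs
    by_contra hne
    refine hs ⟨fun h => Sum.elim (fun e => sC (e, h.2)) (fun e => sP (e.1, h.2)) h.1,
      Finset.mem_coe.mpr (Finset.mem_univ _), ?_⟩
    obtain ⟨hC, hP⟩ := mul_ne_zero_iff.mp hne
    have hzC : ∀ i, sC (C.boundaryHalf (Sum.inl i)) = z i := fun i => by
      have h := right_ne_zero_of_mul hC
      dsimp only at h
      split_ifs at h with h'
      · exact h' _ _ (C.attach_boundaryHalf _)
      · exact absurd rfl h
    have hzP : ∀ h i, P.attach h = Sum.inr i → sP h = z i := by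
      have h := right_ne_zero_of_mul hP
      dsimp only at h
      split_ifs at h with h'
      · exact h'
      · exact absurd rfl h
    have hdiag : ∀ e, (¬ ∀ b, (P.attach (e, b)).isLeft = true) → sP (e, false) = sP (e, true) := by
      intro e he
      have h := Finset.prod_ne_zero_iff.mp (right_ne_zero_of_mul (left_ne_zero_of_mul hP)) e
        (Finset.mem_univ _)
      have hn : ∀ t, (e, t) ∉ patternError C P F := fun t h => he (mem_patternError.mp h).1
      rw [ZXDiagram.edgeOperator_apply] at h
      simpa [hn] using (ite_ne_right_iff.mp h).1
    refine Prod.ext ?_ (Prod.ext rfl ?_)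
    · funext i
      exact hzC i
    · funext ⟨e, b⟩
      dsimp only [patternLabels]
      split_ifs with he
      · rfl
      · obtain ⟨i, c, hi⟩ := P.exists_boundaryIndex he
        rw [P.boundaryIndex_eq he hi]
        refine (hzC i).trans ((hzP _ _ hi).symm.trans ?_)
        have := hdiag e he
        cases b <;> cases c <;> first | rfl | exact this | exact this.symm
  · intro s _
    dsimp only
    have hone : ∀ h i, P.attach h = Sum.inr i → patternLabels C P s h =
        s (Sum.inl (C.boundaryHalf (Sum.inl i)).1, (C.boundaryHalf (Sum.inl i)).2) := by
      rintro ⟨e, b⟩ i hi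
      have he : ¬ ∀ b, (P.attach (e, b)).isLeft = true := fun h' => by simpa [hi] using h' b
      rw [patternLabels, dif_neg he, P.boundaryIndex_eq he hi]
    have hbdry : (∀ h k, (plug C P).attach h = Sum.inr k → s h = y k) ↔
        ∀ h j, C.attach h = Sum.inr j → s (Sum.inl h.1, h.2) = Sum.elim (fun i =>
          s (Sum.inl (C.boundaryHalf (Sum.inl i)).1, (C.boundaryHalf (Sum.inl i)).2)) y j := by
      constructor
      · rintro hs ⟨e, b⟩ (i | k) hj
        · rw [Sum.elim_inl, ← C.eq_boundaryHalf hj]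
        · refine hs _ _ ?_
          exact (plugAttach_inl_eq C P (e, b)).trans (by rw [hj])
      · rintro hs ⟨e | e, b⟩ k hj
        · replace hj := (plugAttach_inl_eq C P (e, b)).symm.trans hj
          rcases hc : C.attach (e, b) with w | i | k'
          · simp [hc] at hj
          · simp [hc] at hj
          · simp only [hc, Sum.inr.injEq] at hj
            subst hj
            exact hs _ _ hc
        · cases hj
    rw [Fintype.prod_sum_type, prod_edgeOperator_plug, if_pos hone, mul_one]
    simp only [nodeTensor_plug_inl, nodeTensor_plug_inr, hbdry]
    ring

end ZXPattern

/-! ### The single Z spider. -/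

open Classical in
theorem interp_zSpider (n : ℕ) (x : Fin (n + 1) → Bool) :
    (zSpider (n + 1)).interp ∅ x = if ∀ j, x j = x (Fin.last n) then 1 else 0 := by
  rw [ZXDiagram.interp_of_phaseFree_Z _ (fun _ => rfl) fun _ => rfl,
    Finset.sum_eq_single fun _ => x (Fin.last n)]
  · simp only [ZXDiagram.edgeOperator_apply, Finset.notMem_empty, decide_false, Bool.xor_false,
      Bool.and_false, boolSign, Bool.false_eq_true, if_false, if_true, Sum.elim_inl, Sum.elim_inr]
    rw [Finset.prod_ite_zero]
    simp [eq_comm]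
  · intro t _ ht
    refine Finset.prod_eq_zero (Finset.mem_univ (Fin.last n)) ?_
    rw [ZXDiagram.edgeOperator_apply, if_neg]
    intro h
    exact ht (funext fun _ => by simpa using h)
  · simp

theorem flipBits_eq_of_interp_zSpider_ne_zero {n : ℕ} {x : Fin (n + 1) → Bool}
    (h : (zSpider (n + 1)).interp ∅ x ≠ 0) (i j : Fin (n + 1)) : x i = x j := by
  classical
  rw [interp_zSpider] at h
  have := (ite_ne_right_iff.mp h).1
  rw [this i, this j]

-- X on all legs stabilizes the Z spider, since equality of all bits survives a global negation.
open Classical in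
theorem interp_zSpider_flipBits_compl (n : ℕ) (A : Finset (Fin (n + 1)))
    (x : Fin (n + 1) → Bool) :
    (zSpider (n + 1)).interp ∅ (flipBits Aᶜ x) = (zSpider (n + 1)).interp ∅ (flipBits A x) := by
  have : ∀ j, flipBits Aᶜ x j = !flipBits A x j := fun j => by
    by_cases hj : j ∈ A <;> simp [flipBits, hj]
  rw [interp_zSpider, interp_zSpider]
  simp only [this, Bool.not_inj_iff]

/-! ### Internal errors of the split spider. -/

namespace splitSpider

variable {n : ℕ} (G : (splitSpider n).Error)

open Classical in
/-- Whether the edge between the outer spider `i` and the hub `c` carries a flip of type `t`. -/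
noncomputable def flipped (t : FlipKind) (i : Fin (n / 2)) (c : Bool) : Bool :=
  decide ((Sum.inr (i, c), t) ∈ G)

open Classical in
/-- The boundary legs at the outer spiders that have an X flip towards the second hub. -/
noncomputable def flippedLegs : Finset (Fin (n + 1)) :=
  Finset.univ.filter fun j => ∃ h : j.val / 2 < n / 2, flipped G FlipKind.X ⟨j.val / 2, h⟩ true

-- The last boundary leg fixes the label of the hub `inr true`, and the edges from that hub fix the
-- labels of the outer spiders. Only the label `a` of the hub `inr false` stays free.
open Classical in
theorem interp_eq_sum (hG : ∀ j t, (Sum.inl j, t) ∉ G) (x : Fin (n + 1) → Bool) :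
    (splitSpider n).interp G x = ∑ a, (zSpider (n + 1)).interp ∅ (flipBits (flippedLegs G) x) *
      ∏ p : Fin (n / 2) × Bool, (splitSpider n).edgeOperator G (Sum.inr p)
        (x (Fin.last n) ^^ flipped G FlipKind.X p.1 true)
        (if p.2 then x (Fin.last n) else a) := by
  rw [ZXDiagram.interp_of_phaseFree_Z _ (fun _ => rfl) fun _ => rfl]
  symm
  refine Finset.sum_of_injOn (fun a => Sum.elim
    (fun i => x (Fin.last n) ^^ flipped G FlipKind.X i true)
    (fun c => if c then x (Fin.last n) else a)) ?_
    (fun _ _ => Finset.mem_coe.mpr (Finset.mem_univ _)) ?_ ?_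
  · intro a _ b _ h
    simpa using congrFun h (Sum.inr false)
  · intro t _ ht
    by_contra hne
    have hne := Finset.prod_ne_zero_iff.mp hne
    refine ht ⟨t (Sum.inr false), Finset.mem_coe.mpr (Finset.mem_univ _), ?_⟩
    have hb : t (Sum.inr true) = x (Fin.last n) := by
      have h := hne (Sum.inl (Fin.last n)) (Finset.mem_univ _)
      rw [ZXDiagram.edgeOperator_apply] at h
      simpa [hG] using (ite_ne_right_iff.mp h).1
    funext v
    obtain i | c := v
    · have h := hne (Sum.inr (i, true)) (Finset.mem_univ _)
      rw [ZXDiagram.edgeOperator_apply] at h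
      have h := (ite_ne_right_iff.mp h).1
      exact ((congrArg (· ^^ _) hb).symm.trans h.symm)
    · cases c
      · rfl
      · exact hb.symm
  · intro a _
    rw [Fintype.prod_sum_type, interp_zSpider]
    congr 1
    have hterm : ∀ j : Fin (n + 1), (splitSpider n).edgeOperator G (Sum.inl j)
        (Sum.elim (Sum.elim (fun i => x (Fin.last n) ^^ flipped G FlipKind.X i true)
          (fun c => if c then x (Fin.last n) else a)) x ((splitSpider n).attach (Sum.inl j, false)))
        (x j) =
        if flipBits (flippedLegs G) x j = flipBits (flippedLegs G) x (Fin.last n)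
          then 1 else 0 := by
      intro j
      have hl : Fin.last n ∉ flippedLegs G := by simp [flippedLegs]
      rw [ZXDiagram.edgeOperator_apply]
      by_cases hj : j.val / 2 < n / 2
      · have hm : j ∈ flippedLegs G ↔ flipped G FlipKind.X ⟨j.val / 2, hj⟩ true := by
          simp [flippedLegs, hj]
        by_cases hX : flipped G FlipKind.X ⟨j.val / 2, hj⟩ true <;>
          cases h1 : x j <;> cases h2 : x (Fin.last n) <;>
          simp [hG, hj, hm, hl, hX, flipBits, boolSign, h1, h2]
      · have hm : j ∉ flippedLegs G := by simp [flippedLegs, hj]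
        cases h1 : x j <;> cases h2 : x (Fin.last n) <;>
          simp [hG, hj, hm, hl, flipBits, boolSign, h1, h2]
    change _ = ∏ j : Fin (n + 1), (splitSpider n).edgeOperator G (Sum.inl j) (Sum.elim _ x _) (x j)
    rw [Finset.prod_congr rfl fun j _ => hterm j, Finset.prod_ite_zero]
    simp

/-- An error is consistent if for all outer spiders the numbers of X flips on the edges to the two
hubs have the same parity. -/
def Consistent (d : Bool) : Prop :=
  ∀ i, (flipped G FlipKind.X i false ^^ flipped G FlipKind.X i true) = d

/-- A nonzero term would make the difference of the two hub labels the common parity at all outer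
spiders. -/
theorem interp_eq_zero (hG : ∀ j t, (Sum.inl j, t) ∉ G) (hd : ∀ d, ¬ Consistent G d) :
    (splitSpider n).interp G = 0 := by
  classical
  funext x
  rw [interp_eq_sum G hG]
  refine Finset.sum_eq_zero fun a _ => mul_eq_zero_of_right _ ?_
  by_contra hne
  have hne := Finset.prod_ne_zero_iff.mp hne
  refine hd (a ^^ x (Fin.last n)) fun i => ?_
  have h := hne (i, false) (Finset.mem_univ _)
  rw [ZXDiagram.edgeOperator_apply] at h
  have h : (x (Fin.last n) ^^ flipped G FlipKind.X i true) = (a ^^ flipped G FlipKind.X i false) :=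
    (ite_ne_right_iff.mp h).1
  revert h
  cases x (Fin.last n) <;> cases a <;> cases flipped G FlipKind.X i true <;>
    cases flipped G FlipKind.X i false <;> simp

/-- A consistent error acts as X flips on boundary legs and a possible sign. -/
theorem interp_of_consistent (hG : ∀ j t, (Sum.inl j, t) ∉ G) {d : Bool} (hd : Consistent G d) :
    ∃ c : ℂ, c ≠ 0 ∧ ∀ x, (splitSpider n).interp G x =
      c * ((∏ p : Fin (n / 2) × Bool, boolSign (x (Fin.last n) && flipped G FlipKind.Z p.1 p.2)) *
        (zSpider (n + 1)).interp ∅ (flipBits (flippedLegs G) x)) := by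
  classical
  rcases isEmpty_or_nonempty (Fin (n / 2)) with he | ⟨⟨i₀⟩⟩
  -- Without outer spiders the hub `inr false` has no legs and is the scalar 2.
  · refine ⟨2, two_ne_zero, fun x => ?_⟩
    rw [interp_eq_sum G hG]
    simp
  -- The hub `inr false` is forced to carry the last boundary bit shifted by `d`; a Z on its edges
  -- reads that bit up to the constant sign collected here.
  · refine ⟨∏ i, boolSign (d && flipped G FlipKind.Z i false),
      Finset.prod_ne_zero_iff.mpr fun i _ => boolSign_ne_zero _, fun x => ?_⟩
    rw [interp_eq_sum G hG, Finset.sum_eq_single (x (Fin.last n) ^^ d)]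
    · rw [mul_comm, ← mul_assoc, Fintype.prod_prod_type, Fintype.prod_prod_type,
        ← Finset.prod_mul_distrib]
      congr 1
      refine Finset.prod_congr rfl fun i _ => ?_
      have hdi := hd i
      simp only [Fintype.prod_bool, ZXDiagram.edgeOperator_apply]
      change (if _ = (_ ^^ flipped G FlipKind.X i true) then
        boolSign (_ && flipped G FlipKind.Z i true) else 0) *
        (if _ = (_ ^^ flipped G FlipKind.X i false) then
        boolSign (_ && flipped G FlipKind.Z i false) else 0) = _
      subst hdi
      cases x (Fin.last n) <;> cases flipped G FlipKind.X i true <;>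
        cases flipped G FlipKind.X i false <;> cases flipped G FlipKind.Z i true <;>
        cases flipped G FlipKind.Z i false <;> simp [boolSign]
    · intro a _ ha
      refine mul_eq_zero_of_right _ (Finset.prod_eq_zero (Finset.mem_univ (i₀, false)) ?_)
      rw [ZXDiagram.edgeOperator_apply, if_neg]
      intro h
      replace h : (x (Fin.last n) ^^ flipped G FlipKind.X i₀ true) =
        (a ^^ flipped G FlipKind.X i₀ false) := h
      have hdi := hd i₀
      subst hdi
      revert h ha
      cases x (Fin.last n) <;> cases a <;> cases flipped G FlipKind.X i₀ true <;>
        cases flipped G FlipKind.X i₀ false <;> simp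
    · simp

open Classical in
theorem card_flippedLegs_le :
    (flippedLegs G).card ≤ 2 * (Finset.univ.filter fun i => flipped G FlipKind.X i true).card := by
  have h : (flippedLegs G).card ≤ ((Finset.univ.filter fun i => flipped G FlipKind.X i true) ×ˢ
      (Finset.univ : Finset (Fin 2))).card := by
    refine le_trans (b := (((Finset.univ.filter fun i => flipped G FlipKind.X i true) ×ˢ
      (Finset.univ : Finset (Fin 2))).image fun p => (p.1.val * 2 + p.2.val)).card) ?_
      Finset.card_image_le
    rw [← Finset.card_map Fin.valEmbedding]
    refine Finset.card_le_card fun k hk => ?_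
    obtain ⟨j, hj, rfl⟩ := Finset.mem_map.mp hk
    obtain ⟨h, hX⟩ := (Finset.mem_filter.mp hj).2
    refine Finset.mem_image.mpr ⟨(⟨j.val / 2, h⟩, ⟨j.val % 2, Nat.mod_lt _ two_pos⟩),
      by simpa using hX, ?_⟩
    exact Nat.div_add_mod' _ _
  simpa [mul_comm] using h

-- The extra 1 is the last leg, which is never flipped. Evenness of `n` makes it the only boundary
-- leg not at an outer spider.
open Classical in
theorem card_compl_flippedLegs_le (hn : Even n) :
    (flippedLegs G)ᶜ.card ≤
      2 * (Finset.univ.filter fun i => ¬ flipped G FlipKind.X i true).card + 1 := by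
  have h : (flippedLegs G)ᶜ.card ≤ ((Finset.univ.filter fun i => ¬ flipped G FlipKind.X i true) ×ˢ
      (Finset.univ : Finset (Fin 2))).card + 1 := by
    refine le_trans (b := (insert n (((Finset.univ.filter fun i =>
      ¬ flipped G FlipKind.X i true) ×ˢ (Finset.univ : Finset (Fin 2))).image
      fun p => (p.1.val * 2 + p.2.val))).card) ?_
      ((Finset.card_insert_le _ _).trans (Nat.add_le_add_right Finset.card_image_le 1))
    rw [← Finset.card_map Fin.valEmbedding]
    refine Finset.card_le_card fun k hk => ?_
    obtain ⟨j, hj, rfl⟩ := Finset.mem_map.mp hk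
    rw [Finset.mem_insert]
    refine or_iff_not_imp_left.mpr fun hjn => ?_
    have hjn : j.val ≠ n := hjn
    have h : j.val / 2 < n / 2 := by
      obtain ⟨m, rfl⟩ := hn
      omega
    refine Finset.mem_image.mpr ⟨(⟨j.val / 2, h⟩, ⟨j.val % 2, Nat.mod_lt _ two_pos⟩), ?_, ?_⟩
    · have hj := Finset.mem_compl.mp hj
      simpa [flippedLegs, h] using hj
    · exact Nat.div_add_mod' _ _
  simpa [mul_comm] using h

theorem mem_image_fst {t : FlipKind} {i : Fin (n / 2)} {c : Bool} (h : flipped G t i c = true) :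
    Sum.inr (i, c) ∈ G.image Prod.fst := by
  classical
  exact Finset.mem_image.mpr ⟨_, of_decide_eq_true h, rfl⟩

/-- The X flips of a consistent error can be moved to at most as many boundary legs. -/
theorem exists_legs (hn : Even n) {d : Bool} (hd : Consistent G d) :
    ∃ A : Finset (Fin (n + 1)), A.card ≤ (splitSpider n).weight G ∧
      ∀ x, (zSpider (n + 1)).interp ∅ (flipBits (flippedLegs G) x) =
        (zSpider (n + 1)).interp ∅ (flipBits A x) := by
  classical
  have h₁ := card_flippedLegs_le G
  have h₂ := card_compl_flippedLegs_le G hn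
  have h₃ := Finset.card_filter_add_card_filter_not (s := (Finset.univ : Finset (Fin (n / 2))))
    fun i => flipped G FlipKind.X i true = true
  rw [Finset.card_univ, Fintype.card_fin] at h₃
  cases d
  · refine ⟨flippedLegs G, h₁.trans ?_, fun _ => rfl⟩
    -- Even parity: a flip towards one hub comes with a flip towards the other, so two edges pay for
    -- two legs.
    refine le_trans (b := ((Finset.univ.filter fun i => flipped G FlipKind.X i true) ×ˢ
      (Finset.univ : Finset Bool)).card) (by simp [mul_comm]) ?_
    refine Finset.card_le_card_of_injOn Sum.inr (fun p hp => ?_) Sum.inr_injective.injOn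
    have hp : flipped G FlipKind.X p.1 true = true := by simpa using hp
    have hp' := hd p.1
    rw [hp, Bool.xor_true, Bool.not_eq_false'] at hp'
    obtain ⟨i, c⟩ := p
    refine Finset.mem_coe.mpr (mem_image_fst G (t := FlipKind.X) ?_)
    cases c
    · exact hp'
    · exact hp
  -- Odd parity: each outer spider has exactly one X-flipped edge, namely the one selected by the
  -- bit `flipped G FlipKind.X i true`.
  · have hw : n / 2 ≤ (splitSpider n).weight G := by
      conv_lhs => rw [← Fintype.card_fin (n / 2), ← Finset.card_univ]
      refine Finset.card_le_card_of_injOn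
        (fun i => Sum.inr (i, flipped G FlipKind.X i true)) (fun i _ => ?_) fun i _ j _ h => ?_
      · refine Finset.mem_coe.mpr (mem_image_fst G (t := FlipKind.X) ?_)
        have hi := hd i
        cases h : flipped G FlipKind.X i true
        · simpa [h] using hi
        · exact h
      · exact (Prod.mk.inj (Sum.inr.inj h)).1
    by_cases hk : (flippedLegs G).card ≤ n / 2
    · exact ⟨flippedLegs G, hk.trans hw, fun _ => rfl⟩
    -- With `k` outer spiders flipped towards the second hub, `2 * k` exceeds `n / 2`, so the bound
    -- `2 * (n / 2 - k) + 1` for the complement is at most `n / 2`.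
    · refine ⟨(flippedLegs G)ᶜ, le_trans ?_ hw, fun x =>
        (interp_zSpider_flipBits_compl n _ x).symm⟩
      omega

open Classical in
/-- A consistent error on the internal edges acts, up to a scalar, as Pauli operators on at most as
many boundary legs. -/
theorem exists_pauli (hn : Even n) (hG : ∀ j t, (Sum.inl j, t) ∉ G) {d : Bool}
    (hd : Consistent G d) :
    ∃ A B : Finset (Fin (n + 1)), (A ∪ B).card ≤ (splitSpider n).weight G ∧
      ∃ c : ℂ, c ≠ 0 ∧ ∀ x, (splitSpider n).interp G x =
        c * ((∏ j ∈ B, boolSign (x j)) * (zSpider (n + 1)).interp ∅ (flipBits A x)) := by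
  obtain ⟨A, hA, hAx⟩ := exists_legs G hn hd
  obtain ⟨c, hc, hcx⟩ := interp_of_consistent G hG hd
  -- All Z flips read the same bit, so only their parity matters; an odd parity also exhibits an
  -- edge that pays for the remaining Z.
  have hsign : ∀ s : Finset (Fin (n / 2) × Bool),
      (∀ b, ∏ p ∈ s, boolSign (b && flipped G FlipKind.Z p.1 p.2) = 1) ∨
      (∃ p : Fin (n / 2) × Bool, flipped G FlipKind.Z p.1 p.2 = true) ∧
        ∀ b, ∏ p ∈ s, boolSign (b && flipped G FlipKind.Z p.1 p.2) = boolSign b := by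
    intro s
    induction s using Finset.induction_on with
    | empty => exact Or.inl fun b => Finset.prod_empty
    | insert p s hp ih =>
      simp only [Finset.prod_insert hp]
      cases h : flipped G FlipKind.Z p.1 p.2
      · simpa [boolSign] using ih
      · rcases ih with ih | ⟨-, ih⟩
        · exact Or.inr ⟨⟨p, h⟩, fun b => by rw [ih, mul_one, Bool.and_true]⟩
        · refine Or.inl fun b => ?_
          rw [ih, Bool.and_true, ← boolSign_xor, Bool.xor_self]
          rfl
  rcases hsign Finset.univ with h | ⟨⟨p, hp⟩, h⟩
  · refine ⟨A, ∅, by simpa using hA, c, hc, fun x => ?_⟩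
    rw [hcx, h, hAx, Finset.prod_empty]
  · have hw : 1 ≤ (splitSpider n).weight G := Finset.card_pos.mpr ⟨_, mem_image_fst G hp⟩
    -- The remaining Z goes on a leg that already carries an X, if there is one.
    obtain ⟨j, hj⟩ : ∃ j, (A ∪ {j}).card ≤ (splitSpider n).weight G := by
      rcases A.eq_empty_or_nonempty with rfl | ⟨j, hj⟩
      · exact ⟨0, by simpa using hw⟩
      · exact ⟨j, by rwa [Finset.union_eq_left.mpr (Finset.singleton_subset_iff.mpr hj)]⟩
    -- On the support, leg `j` and the last leg agree after the flips of `A`, so moving Z between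
    -- them costs a constant sign.
    refine ⟨A, {j}, hj, c * boolSign (decide (j ∈ A) ^^ decide (Fin.last n ∈ A)),
      mul_ne_zero hc (boolSign_ne_zero _), fun x => ?_⟩
    rw [hcx, h, hAx, Finset.prod_singleton]
    by_cases h0 : (zSpider (n + 1)).interp ∅ (flipBits A x) = 0
    · rw [h0]
      simp
    · have hx := flipBits_eq_of_interp_zSpider_ne_zero h0 j (Fin.last n)
      have : boolSign (x (Fin.last n)) =
          boolSign (decide (j ∈ A) ^^ decide (Fin.last n ∈ A)) * boolSign (x j) := by
        rw [← boolSign_xor]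
        congr 1
        unfold flipBits at hx
        revert hx
        by_cases hj : j ∈ A <;> by_cases hl : Fin.last n ∈ A <;>
          cases x j <;> cases x (Fin.last n) <;> simp [hj, hl]
      rw [this]
      ring

end splitSpider

/-! ### Comparing distances by simulating errors. -/

namespace EqUpToScalar

variable {ι : Type} {f g h : (ι → Bool) → ℂ}

theorem symm (hfg : EqUpToScalar f g) : EqUpToScalar g f := by
  obtain ⟨c, hc, rfl⟩ := hfg
  exact ⟨c⁻¹, inv_ne_zero hc, (inv_smul_smul₀ hc g).symm⟩

theorem trans (hfg : EqUpToScalar f g) (hgh : EqUpToScalar g h) : EqUpToScalar f h := by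
  obtain ⟨c, hc, rfl⟩ := hfg
  obtain ⟨d, hd, rfl⟩ := hgh
  exact ⟨c * d, mul_ne_zero hc hd, (mul_smul c d h).symm⟩

end EqUpToScalar

/-- If every undetectable error on `D'` has the same effect as an error on `D` of at most the same
weight, then the distance of `D` is at most that of `D'`. -/
theorem ZXDiagram.distance_le_distance {κ : Type} {D D' : ZXDiagram κ}
    (h₀ : EqUpToScalar (D'.interp ∅) (D.interp ∅))
    (h : ∀ F, D'.interp F = 0 ∨
      ∃ F', D.weight F' ≤ D'.weight F ∧ EqUpToScalar (D'.interp F) (D.interp F')) :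
    D.distance ≤ D'.distance := by
  refine le_iInf₂ fun F hF => ?_
  obtain ⟨F', hw, hF'⟩ := (h F).resolve_left hF.2
  refine (iInf₂_le F' ⟨fun ht => hF.1 (hF'.trans (ht.trans h₀.symm)), fun hd => hF.2 ?_⟩).trans
    (Nat.cast_le.mpr hw)
  obtain ⟨c, -, hc⟩ := hF'
  rw [ZXDiagram.IsDetectable, hc, hd, smul_zero]

/-! ### Criteria for replacing a pattern inside a context. -/

namespace ZXPattern

variable {ι κ : Type}

/-- An error on the context, as an error on a plugged diagram. -/
noncomputable def liftError (C : ZXDiagram (ι ⊕ κ)) (P : ZXPattern ι) (F : C.Error) :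
    (plug C P).Error :=
  F.map ⟨fun p => (Sum.inl p.1, p.2), fun p q h => by
    simp only [Prod.mk.injEq, Sum.inl.injEq] at h
    exact Prod.ext h.1 h.2⟩

theorem contextError_liftError (C : ZXDiagram (ι ⊕ κ)) (P : ZXPattern ι) (F : C.Error) :
    contextError C P (liftError C P F) = F := by
  ext ⟨e, t⟩
  rw [mem_contextError]
  constructor
  · intro h
    obtain ⟨⟨e', t'⟩, h₁, h₂⟩ := Finset.mem_map.mp h
    obtain ⟨h₃, rfl⟩ := Prod.mk.inj (show (Sum.inl e', t') = (Sum.inl e, t) from h₂)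
    rwa [← Sum.inl.inj h₃]
  · exact fun h => Finset.mem_map.mpr ⟨_, h, rfl⟩

theorem patternError_liftError (C : ZXDiagram (ι ⊕ κ)) (P : ZXPattern ι) (F : C.Error) :
    patternError C P (liftError C P F) = ∅ := by
  refine Finset.eq_empty_of_forall_notMem fun ⟨e, t⟩ h => ?_
  obtain ⟨he, h⟩ := mem_patternError.mp h
  obtain ⟨_, -, h⟩ := Finset.mem_map.mp h
  cases (Prod.mk.inj h).1

theorem weight_liftError_le (C : ZXDiagram (ι ⊕ κ)) (P : ZXPattern ι) (F : C.Error) :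
    (plug C P).weight (liftError C P F) ≤ C.weight F := by
  classical
  refine (Finset.card_le_card (t := (F.image Prod.fst).image Sum.inl) fun e he => ?_).trans
    Finset.card_image_le
  obtain ⟨p, hp, rfl⟩ := Finset.mem_image.mp he
  obtain ⟨q, hq, rfl⟩ := Finset.mem_map.mp hp
  exact Finset.mem_image_of_mem _ (Finset.mem_image_of_mem _ hq)

theorem interp_liftError [Fintype ι] [DecidableEq ι] (C : ZXDiagram (ι ⊕ κ)) (P : ZXPattern ι)
    (F : C.Error) (y : κ → Bool) :
    (plug C P).interp (liftError C P F) y =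
      ∑ z : ι → Bool, C.interp F (Sum.elim z y) * P.interp ∅ z := by
  rw [interp_plug, contextError_liftError, patternError_liftError]

theorem liftError_empty (C : ZXDiagram (ι ⊕ κ)) (P : ZXPattern ι) : liftError C P ∅ = ∅ := rfl

theorem eqUpToScalar_interp_liftError [Fintype ι] [DecidableEq ι] (C : ZXDiagram (ι ⊕ κ))
    {P Q : ZXPattern ι} (h : EqUpToScalar (P.interp ∅) (Q.interp ∅)) (F : C.Error) :
    EqUpToScalar ((plug C P).interp (liftError C P F)) ((plug C Q).interp (liftError C Q F)) := by
  obtain ⟨c, hc, h⟩ := h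
  refine ⟨c, hc, funext fun y => ?_⟩
  rw [interp_liftError, Pi.smul_apply, interp_liftError, h, smul_eq_mul, Finset.mul_sum]
  exact Finset.sum_congr rfl fun z _ => mul_left_comm _ _ _

theorem eqUpToScalar_interp_plug [Fintype ι] [DecidableEq ι] (C : ZXDiagram (ι ⊕ κ))
    {P Q : ZXPattern ι} (h : EqUpToScalar (P.interp ∅) (Q.interp ∅)) :
    EqUpToScalar ((plug C P).interp ∅) ((plug C Q).interp ∅) := by
  simpa only [liftError_empty] using eqUpToScalar_interp_liftError C h ∅

/-- A pattern without internal edges can be replaced by any pattern of the same interpretation. -/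
theorem distanceNonDecreasing_of_isEmpty_internalEdge [Fintype ι] [DecidableEq ι]
    {P Q : ZXPattern ι} [IsEmpty Q.InternalEdge] (h : EqUpToScalar (Q.interp ∅) (P.interp ∅)) :
    DistanceNonDecreasing P Q := by
  intro κ C
  refine ZXDiagram.distance_le_distance (eqUpToScalar_interp_plug C h) fun F => Or.inr
    ⟨liftError C P (contextError C Q F), (weight_liftError_le C P _).trans
      ((Nat.le_add_right _ _).trans (weight_contextError_add_weight_patternError_le C Q F)), ?_⟩
  have hF : F = liftError C Q (contextError C Q F) := by
    ext ⟨e | e, t⟩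
    · rw [← mem_contextError, ← mem_contextError, contextError_liftError]
    · exact isEmptyElim e
  conv_lhs => rw [hF]
  exact eqUpToScalar_interp_liftError C h _

/-- If every error on the internal edges of `Q` annihilates `Q` or acts on `P` as Pauli operators on
at most as many boundary legs, then replacing `P` by `Q` does not decrease distances. -/
theorem distanceNonDecreasing_of_pauli [Fintype ι] [DecidableEq ι] {P Q : ZXPattern ι}
    (h₀ : EqUpToScalar (Q.interp ∅) (P.interp ∅))
    (h : ∀ G : Q.Error, (∀ e t, (e, t) ∈ G → ∀ b, (Q.attach (e, b)).isLeft = true) →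
      Q.interp G = 0 ∨ ∃ A B : Finset ι, (A ∪ B).card ≤ Q.weight G ∧ ∃ c : ℂ, c ≠ 0 ∧
        ∀ x, Q.interp G x = c * ((∏ j ∈ B, boolSign (x j)) * P.interp ∅ (flipBits A x))) :
    DistanceNonDecreasing P Q := by
  classical
  intro κ C
  refine ZXDiagram.distance_le_distance (eqUpToScalar_interp_plug C h₀) fun F => ?_
  refine (h (patternError C Q F) fun e t he => (mem_patternError.mp he).1).imp (fun hQ => ?_) ?_
  · funext y
    rw [interp_plug, hQ]
    simp
  rintro ⟨A, B, hw, c, hc, hQ⟩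
  obtain ⟨F', hF', d, hd, hC⟩ := C.exists_interp_pauli (contextError C Q F)
    (A.map Function.Embedding.inl) (B.map Function.Embedding.inl)
  refine ⟨liftError C P F', ?_, EqUpToScalar.symm ⟨d * (∏ j ∈ B, boolSign (decide (j ∈ A))) * c⁻¹,
    mul_ne_zero (mul_ne_zero hd (Finset.prod_ne_zero_iff.mpr fun _ _ => boolSign_ne_zero _))
      (inv_ne_zero hc), funext fun y => ?_⟩⟩
  · refine (weight_liftError_le C P F').trans (le_trans ?_
      (weight_contextError_add_weight_patternError_le C Q F))
    refine hF'.trans (Nat.add_le_add_left (le_trans (Finset.card_le_card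
      (t := (A ∪ B).map Function.Embedding.inl) fun j hj => ?_)
      ((Finset.card_map _).trans_le hw)) _)
    rw [Finset.map_union]
    simpa only [Finset.mem_union] using hj
  · rw [interp_liftError, Pi.smul_apply, interp_plug, smul_eq_mul, Finset.mul_sum]
    -- Substituting the flipped port values moves the X operators from the pattern to the context;
    -- passing the Z operators through them leaves the constant sign over `B`.
    refine Fintype.sum_equiv (flipBitsEquiv A) _ _ fun z => ?_
    change _ = _ * (C.interp _ (Sum.elim (flipBits A z) y) * Q.interp _ (flipBits A z))
    have hz : flipBits (A.map Function.Embedding.inl) (Sum.elim z y) =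
        Sum.elim (flipBits A z) y := by
      funext j
      rcases j with j | j <;> simp [flipBits]
    have hB : ∏ j ∈ B, boolSign (flipBits A z j) =
        (∏ j ∈ B, boolSign (z j)) * ∏ j ∈ B, boolSign (decide (j ∈ A)) := by
      rw [← Finset.prod_mul_distrib]
      exact Finset.prod_congr rfl fun j _ => by
        rw [← boolSign_xor]
        by_cases hj : j ∈ A <;> simp [flipBits, hj]
    have hsq : (∏ j ∈ B, boolSign (decide (j ∈ A))) * ∏ j ∈ B, boolSign (decide (j ∈ A)) = 1 := by
      rw [← Finset.prod_mul_distrib]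
      refine Finset.prod_eq_one fun j _ => ?_
      rw [← boolSign_xor, Bool.xor_self]
      rfl
    rw [hC, hz, hQ, hB, flipBits_flipBits, Finset.prod_map]
    simp only [Function.Embedding.inl_apply, Sum.elim_inl]
    field_simp
    linear_combination (-((∏ j ∈ B, boolSign (z j)) * C.interp (contextError C Q F)
      (Sum.elim (flipBits A z) y) * P.interp ∅ z)) * hsq

end ZXPattern

theorem mainTheorem4 (n : ℕ) (hn : Even n) :
    ZXPattern.DistancePreserving (zSpider (n + 1)) (splitSpider n) := by
  have hE : EqUpToScalar ((splitSpider n).interp ∅) ((zSpider (n + 1)).interp ∅) := by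
    -- Equality of interpretations is the case of the empty error: weight zero leaves no leg for a
    -- Pauli operator.
    obtain ⟨A, B, hAB, c, hc, h⟩ := splitSpider.exists_pauli (n := n) ∅ hn (by simp)
      (d := false) fun i => by simp [splitSpider.flipped]
    have hAB : A ∪ B = ∅ := by simpa [ZXDiagram.weight] using hAB
    obtain ⟨rfl, rfl⟩ := Finset.union_eq_empty.mp hAB
    refine ⟨c, hc, funext fun x => ?_⟩
    have : flipBits ∅ x = x := by
      funext j
      simp [flipBits]
    rw [h, this, Finset.prod_empty, one_mul, Pi.smul_apply, smul_eq_mul]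
  have : IsEmpty (zSpider (n + 1)).InternalEdge := ⟨fun e => by simpa using e.2 true⟩
  refine ⟨hE.symm, ZXPattern.distanceNonDecreasing_of_pauli hE fun G hG => ?_,
    ZXPattern.distanceNonDecreasing_of_isEmpty_internalEdge hE.symm⟩
  have hG : ∀ j t, (Sum.inl j, t) ∉ G := fun j t h => by simpa using hG _ t h true
  by_cases hd : ∃ d, splitSpider.Consistent G d
  · obtain ⟨d, hd⟩ := hd
    exact Or.inr (splitSpider.exists_pauli G hn hG hd)
  · exact Or.inl (splitSpider.interp_eq_zero G hG fun d h => hd ⟨d, h⟩)
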